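/- Let $p$ be a prime, let $s,r,m\ge 1$ be integers, and put $q=p^r$, $n=q^m-1$. Let $L=GR(p^s,r)$ be the Galois ring of characteristic $p^s$ and cardinality $p^{sr}$, i.e. the commutative local ring with this characteristic and cardinality whose maximal ideal is $pL$ (so $L/pL\cong\mathbb{F}_q$). Let $h(x)\in L[x]$ be a monic basic primitive polynomial of degree $m$ (its reduction modulo $p$ is a primitive polynomial over $\mathbb{F}_q$) which divides $x^{n}-1$, and suppose that the class $\xi$ of $x$, a root of $h$ in $L[x]/(h(x))$, has multiplicative order $n$. For $0\le i\le n-1$ write uniquely $$\xi^i=b_{1i}+b_{2i}\xi+\dots+b_{mi}\xi^{m-1},\qquad b_{ji}\in L,$$ and let $\mathbf v_j=(0,b_{j0},b_{j1},\dots,b_{j,n-1})\in L^{q^m}$ for $1\le j\le m$. With products and powers in $L^{q^m}$ taken componentwise (a zeroth power being the all-one tuple), the $q^m$-tuples $$\mathbf v_1^{i_1}\mathbf v_2^{i_2}\cdots\mathbf v_m^{i_m},\qquad 0\le i_j\le q-1,\quad 1\le j\le m,$$ indexed by $(i_1,\dots,i_m)$, form a basis of the free $L$-module $L^{q^m}$.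 -/

import Mathlib

open Polynomial

/-- `L` is the Galois ring `GR(p^s, r)`: the (finite) commutative local ring of characteristic `p^s`
and cardinality `p^(sr)` whose maximal ideal is generated by `p`
(so that its residue field is `L/pL`, with `p^r` elements). -/
structure IsGaloisRing (p s r : ℕ) (L : Type*) [CommRing L] : Prop where
  isLocalRing : IsLocalRing L
  charP : CharP L (p ^ s)
  card_eq : Nat.card L = p ^ (s * r)
  maximalIdeal_eq : IsLocalRing.maximalIdeal L = Ideal.span {(p : L)}

namespace GRM

/-- Reduction of the coefficients of a polynomial modulo `p`, from `L[X]` to `(L/pL)[X]`. -/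
noncomputable def reduce {L : Type*} [CommRing L] (p : ℕ) (h : L[X]) :
    (L ⧸ Ideal.span {(p : L)})[X] :=
  h.map (Ideal.Quotient.mk (Ideal.span {(p : L)}))

/-- `h` is a monic basic primitive polynomial of degree `m` over `L`, where `L/pL` is the field with
`q` elements: its reduction modulo `p` is a primitive polynomial, that is, it is irreducible over
`L/pL` and the class of `X` has multiplicative order `q^m - 1` in the field it defines. -/
structure IsMonicBasicPrimitive {L : Type*} [CommRing L] (p q m : ℕ) (h : L[X]) : Prop where
  monic : h.Monic
  natDegree_eq : h.natDegree = m
  irreducible_reduce : Irreducible (reduce p h)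
  orderOf_root_reduce : orderOf (AdjoinRoot.root (reduce p h)) = q ^ m - 1

variable {L : Type*} [CommRing L]

/-- The basis `1, ξ, …, ξ^(m-1)` of `L[X]/(h)` over `L`, where `ξ` is the class of `X`
and `h` is monic of degree `m`. -/
noncomputable def powBasis {m : ℕ} (h : L[X]) (hmonic : h.Monic) (hdeg : h.natDegree = m) :
    Module.Basis (Fin m) L (AdjoinRoot h) :=
  (AdjoinRoot.powerBasis' hmonic).basis.reindex
    (finCongr ((AdjoinRoot.powerBasis'_dim hmonic).trans hdeg))

theorem powBasis_apply {m : ℕ} (h : L[X]) (hmonic : h.Monic) (hdeg : h.natDegree = m)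
    (j : Fin m) : powBasis h hmonic hdeg j = AdjoinRoot.root h ^ (j : ℕ) := by
  simp [powBasis]

/-- The `N`-tuple `(0, 1, ξ, ξ^2, …, ξ^(N-2))`. -/
noncomputable def points (h : L[X]) (N : ℕ) (k : Fin N) : AdjoinRoot h :=
  if (k : ℕ) = 0 then 0 else AdjoinRoot.root h ^ ((k : ℕ) - 1)

/-- The `(m+1) × q^m` matrix `G`. Row `0` is the all-one row; rows `1, …, m` are obtained by
writing each entry of `(0, 1, ξ, …, ξ^(n-1))`, `n = q^m - 1`, as the column of its coordinates
with respect to `1, ξ, …, ξ^(m-1)`. -/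
noncomputable def genMatrix {m : ℕ} (q : ℕ) (h : L[X]) (hmonic : h.Monic)
    (hdeg : h.natDegree = m) : Matrix (Fin (m + 1)) (Fin (q ^ m)) L :=
  Matrix.of (Fin.cons (fun _ => 1)
    (fun (j : Fin m) (k : Fin (q ^ m)) =>
      (powBasis h hmonic hdeg).repr (points h (q ^ m) k) j))

/-- The componentwise product `v_1^(i_1) ⋯ v_m^(i_m)` in `L^(q^m)`, where `v_j` is row `j` of `G`
(`j = 1, …, m`). -/
noncomputable def rowMonomial {m : ℕ} (q : ℕ) (h : L[X]) (hmonic : h.Monic)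
    (hdeg : h.natDegree = m) (i : Fin m → Fin q) : Fin (q ^ m) → L :=
  ∏ j : Fin m, (genMatrix q h hmonic hdeg).row j.succ ^ (i j : ℕ)

end GRM

namespace GRM

/-! Over the local ring `L` a square matrix is invertible iff its determinant is nonzero in the
residue field `K = L/pL`, so the question can be settled modulo `p`. There the coordinate columns of
`0, 1, ξ, …` stay distinct (`injective_coordinates_mod`). Since `K` has exactly `q` elements
(`card_quotient_le` gives one bound, the `q ^ m` distinct columns the other), they exhaust `K^m`. A
kernel vector of the reduced matrix is then a polynomial of degree below `q` in each variable
vanishing on all of `K^m`, hence zero (`det_monomial_ne_zero`). -/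

/-- In a local ring with maximal ideal `(t)`, passing from `(t ^ (i + 1))` to `(t ^ i)` multiplies
the cardinality by at least that of the residue ring, as long as `t ^ i ≠ 0`. -/
theorem card_quotient_mul_card_span_pow_succ_le {L : Type*} [CommRing L] [IsLocalRing L] [Finite L]
    {t : L} (ht : IsLocalRing.maximalIdeal L = Ideal.span {t}) {i : ℕ} (hi : t ^ i ≠ 0) :
    Nat.card (L ⧸ Ideal.span {t}) * Nat.card (Ideal.span {t ^ (i + 1)}) ≤
      Nat.card (Ideal.span {t ^ i}) := by
  rw [← Nat.card_prod]
  have hmem (x : (L ⧸ Ideal.span {t}) × Ideal.span {t ^ (i + 1)}) :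
      t ^ i * x.1.out + x.2 ∈ Ideal.span {t ^ i} :=
    add_mem (Ideal.mem_span_singleton.2 (dvd_mul_right _ _))
      (Ideal.mem_span_singleton.2 ((pow_dvd_pow t i.le_succ).trans
        (Ideal.mem_span_singleton.1 x.2.2)))
  refine Nat.card_le_card_of_injective (fun x ↦ ⟨_, hmem x⟩) ?_
  rintro ⟨a, y, hy⟩ ⟨b, z, hz⟩ hxy
  have hxy' : t ^ i * a.out + y = t ^ i * b.out + z := congrArg Subtype.val hxy
  have hab : a = b := by
    by_contra hne
    have hnot : a.out - b.out ∉ Ideal.span {t} := fun hmem ↦ hne <| by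
      simpa using (Ideal.Quotient.eq (I := Ideal.span {t})).2 hmem
    obtain ⟨c, rfl⟩ := Ideal.mem_span_singleton.1 hy
    obtain ⟨d, rfl⟩ := Ideal.mem_span_singleton.1 hz
    -- The two equal sums differ by `t ^ i` times this element, so its being a unit forces `t ^ i =
    -- 0`.
    have hunit : IsUnit (a.out - b.out + t * (c - d)) := by
      rw [← IsLocalRing.notMem_maximalIdeal, ht]
      exact fun hmem ↦ hnot <| (add_mem_cancel_right
        (Ideal.mem_span_singleton.2 (dvd_mul_right _ _))).1 hmem
    exact hi (hunit.mul_left_eq_zero.1 (by linear_combination hxy'))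
  subst hab
  simpa using hxy'

/-- Telescopes the previous bound along the chain `L ⊇ (t) ⊇ (t²) ⊇ ⋯ ⊇ (t ^ s)`. -/
theorem card_quotient_pow_le {L : Type*} [CommRing L] [IsLocalRing L] [Finite L]
    {t : L} (ht : IsLocalRing.maximalIdeal L = Ideal.span {t}) {s : ℕ}
    (hs : ∀ i < s, t ^ i ≠ 0) :
    Nat.card (L ⧸ Ideal.span {t}) ^ s ≤ Nat.card L := by
  suffices ∀ i ≤ s, Nat.card (L ⧸ Ideal.span {t}) ^ i * Nat.card (Ideal.span {t ^ i}) ≤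
      Nat.card L from
    (Nat.le_mul_of_pos_right _ Nat.card_pos).trans (this s le_rfl)
  intro i hi
  induction i with
  | zero => simp
  | succ i ih =>
    rw [pow_succ, mul_assoc]
    exact (Nat.mul_le_mul_left _
      (card_quotient_mul_card_span_pow_succ_le ht (hs i hi))).trans (ih (by omega))

/-- The residue field of `GR(p^s, r)` has at most `p^r` elements. -/
theorem card_quotient_le {p s r : ℕ} (hp : p.Prime) (hs : 1 ≤ s) {L : Type*} [CommRing L]
    (hL : IsGaloisRing p s r L) : Nat.card (L ⧸ Ideal.span {(p : L)}) ≤ p ^ r := by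
  have := hL.isLocalRing
  have := hL.charP
  have : Finite L := Nat.finite_of_card_ne_zero <| by
    rw [hL.card_eq]; exact (pow_pos hp.pos _).ne'
  have hle := card_quotient_pow_le hL.maximalIdeal_eq (s := s) fun i hi h0 ↦ by
    have hdvd : p ^ s ∣ p ^ i := (CharP.cast_eq_zero_iff L (p ^ s) (p ^ i)).1 (by simpa using h0)
    exact absurd ((Nat.pow_dvd_pow_iff_le_right hp.one_lt).1 hdvd) (by omega)
  rw [hL.card_eq, mul_comm, pow_mul] at hle
  exact (Nat.pow_le_pow_iff_left (by omega)).1 hle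

/-- If a monoid with zero contains an element `x` of order `N - 1`, the `N` elements
`0, 1, x, …, x ^ (N - 2)` are distinct. -/
theorem injective_zero_pow {M : Type*} [MonoidWithZero M] [Nontrivial M] {x : M}
    {N : ℕ} (hx : orderOf x = N - 1) :
    Function.Injective (fun k : Fin N ↦ if (k : ℕ) = 0 then (0 : M) else x ^ ((k : ℕ) - 1)) := by
  intro k l hkl
  have hne (k : Fin N) (hk : (k : ℕ) ≠ 0) (e : ℕ) : x ^ e ≠ 0 := by
    -- A nonzero index in `Fin N` forces `N ≥ 2`, so `x` has positive finite order.
    have hpos : N - 1 ≠ 0 := by omega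
    have hunit : IsUnit x := IsUnit.of_pow_eq_one (hx ▸ pow_orderOf_eq_one x) hpos
    exact (hunit.pow e).ne_zero
  dsimp only at hkl
  split_ifs at hkl with h1 h2 h2
  · exact Fin.ext (h1.trans h2.symm)
  · exact absurd hkl.symm (hne l h2 _)
  · exact absurd hkl (hne k h1 _)
  · have := pow_injOn_Iio_orderOf (x := x) (by simp only [Set.mem_Iio]; omega)
      (by simp only [Set.mem_Iio]; omega) hkl
    exact Fin.ext (by omega)

/-- The coordinate vectors of the points `0, 1, ξ, …` remain distinct modulo `p`. -/
theorem injective_coordinates_mod {L : Type*} [CommRing L] {p q m : ℕ} {h : L[X]}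
    (hh : IsMonicBasicPrimitive p q m h) :
    Function.Injective (fun (k : Fin (q ^ m)) (j : Fin m) ↦
      Ideal.Quotient.mk (Ideal.span {(p : L)})
        ((powBasis h hh.monic hh.natDegree_eq).repr (points h (q ^ m) k) j)) := by
  set π := Ideal.Quotient.mk (Ideal.span {(p : L)})
  set b := powBasis h hh.monic hh.natDegree_eq with hb
  let φ : AdjoinRoot h →+* AdjoinRoot (reduce p h) :=
    AdjoinRoot.lift ((AdjoinRoot.of _).comp π) (AdjoinRoot.root _) (by
      rw [← Polynomial.eval₂_map]; exact AdjoinRoot.eval₂_root _)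
  have hφ (k : Fin (q ^ m)) : φ (points h (q ^ m) k) =
      if (k : ℕ) = 0 then 0 else AdjoinRoot.root (reduce p h) ^ ((k : ℕ) - 1) := by
    unfold points
    split_ifs <;> simp [φ]
  -- Thus `φ y` depends only on the coordinates of `y` modulo `p`.
  have hsum (y : AdjoinRoot h) : φ y =
      ∑ j, AdjoinRoot.of (reduce p h) (π (b.repr y j)) * AdjoinRoot.root (reduce p h) ^ (j : ℕ) := by
    conv_lhs => rw [← b.sum_repr y]
    simp [φ, hb, powBasis_apply, Algebra.smul_def, AdjoinRoot.algebraMap_eq]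
  have : Nontrivial (AdjoinRoot (reduce p h)) :=
    Ideal.Quotient.nontrivial_iff.2 fun htop ↦
      hh.irreducible_reduce.not_isUnit (Ideal.span_singleton_eq_top.1 htop)
  intro k l hkl
  apply injective_zero_pow hh.orderOf_root_reduce
  dsimp only
  rw [← hφ, ← hφ, hsum, hsum]
  exact Finset.sum_congr rfl fun j _ ↦ by rw [show π _ = π _ from congrFun hkl j]

/-- Over a domain with at least `q` elements, a polynomial of degree less than `q` in each variable
that vanishes everywhere has zero coefficients. -/
theorem coeff_eq_zero_of_forall_sum_eq_zero {K : Type*} [CommRing K] [IsDomain K] [Finite K] {m q : ℕ}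
    (hq : q ≤ Nat.card K) (c : (Fin m → Fin q) → K)
    (hc : ∀ x : Fin m → K, ∑ i, c i * ∏ j, x j ^ (i j : ℕ) = 0) : c = 0 := by
  classical
  have := Fintype.ofFinite K
  let e (i : Fin m → Fin q) : Fin m →₀ ℕ := Finsupp.equivFunOnFinite.symm fun j ↦ (i j : ℕ)
  have he : Function.Injective e := fun i i' hii ↦ funext fun j ↦ Fin.ext <| by
    simpa [e] using DFunLike.congr_fun hii j
  let f : MvPolynomial (Fin m) K := ∑ i, MvPolynomial.monomial (e i) (c i)
  have hf : f = 0 := by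
    refine MvPolynomial.eq_zero_of_eval_zero_at_prod_finset f (fun _ ↦ Finset.univ) ?_ ?_
    · intro j
      rcases isEmpty_or_nonempty (Fin m → Fin q) with hemp | ⟨⟨i₀⟩⟩
      · simp [f, Fintype.card_pos]
      rw [MvPolynomial.degreeOf_lt_iff (by simp [Fintype.card_pos])]
      intro d hd
      obtain ⟨i, -, hi⟩ := Finset.mem_biUnion.1 (MvPolynomial.support_sum hd)
      have := Finset.mem_singleton.1 (MvPolynomial.support_monomial_subset hi)
      subst this
      rw [Finset.card_univ, ← Nat.card_eq_fintype_card]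
      exact (i j).2.trans_le hq
    · intro x _
      simpa [f, e, MvPolynomial.eval_monomial, Finsupp.prod_fintype] using hc x
  funext i
  have := congrArg (MvPolynomial.coeff (e i)) hf
  simpa [f, MvPolynomial.coeff_sum, MvPolynomial.coeff_monomial, he.eq_iff] using this

/-- The monomials of degree less than `q` in each variable, evaluated at points which exhaust `K^m`,
form an invertible matrix. -/
theorem det_monomial_ne_zero {K : Type*} [CommRing K] [IsDomain K] [Finite K] {m q : ℕ} (hq : q ≤ Nat.card K)
    (P : (Fin m → Fin q) → Fin m → K) (hP : Function.Surjective P) :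
    (Matrix.of fun k i : Fin m → Fin q ↦ ∏ j, P k j ^ (i j : ℕ)).det ≠ 0 := by
  intro h0
  obtain ⟨c, hc, hc0⟩ := Matrix.exists_mulVec_eq_zero_iff.2 h0
  refine hc (coeff_eq_zero_of_forall_sum_eq_zero hq c fun x ↦ ?_)
  obtain ⟨k, rfl⟩ := hP x
  simpa [Matrix.mulVec, dotProduct, mul_comm] using congrFun hc0 k

end GRM

theorem mainTheorem8 (p s r m q : ℕ) (hp : p.Prime) (hs : 1 ≤ s) (hr : 1 ≤ r) (hm : 1 ≤ m)
    (hq : q = p ^ r) (L : Type*) [CommRing L] (hL : IsGaloisRing p s r L)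
    (h : Polynomial L) (hh : GRM.IsMonicBasicPrimitive p q m h)
    (hdvd : h ∣ Polynomial.X ^ (q ^ m - 1) - 1)
    (hord : orderOf (AdjoinRoot.root h) = q ^ m - 1) :
    ∃ B : Module.Basis (Fin m → Fin q) L (Fin (q ^ m) → L),
      ∀ i : Fin m → Fin q, B i = GRM.rowMonomial q h hh.monic hh.natDegree_eq i := by
  classical
  have := hL.isLocalRing
  have : Finite L := Nat.finite_of_card_ne_zero <| by
    rw [hL.card_eq]; exact (pow_pos hp.pos _).ne'
  have : (Ideal.span {(p : L)}).IsMaximal :=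
    hL.maximalIdeal_eq ▸ IsLocalRing.maximalIdeal.isMaximal L
  have : Finite (L ⧸ Ideal.span {(p : L)}) :=
    Finite.of_surjective _ Ideal.Quotient.mk_surjective
  have hle : Nat.card (L ⧸ Ideal.span {(p : L)}) ≤ q := hq ▸ GRM.card_quotient_le hp hs hL
  have hinj := GRM.injective_coordinates_mod hh
  have hge : q ≤ Nat.card (L ⧸ Ideal.span {(p : L)}) := by
    have := Nat.card_le_card_of_injective _ hinj
    rw [Nat.card_fun, Nat.card_fin, Nat.card_fin] at this
    exact (Nat.pow_le_pow_iff_left (by omega)).1 this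
  have hbij := hinj.bijective_of_nat_card_le (by
    rw [Nat.card_fun, Nat.card_fin, Nat.card_fin]; exact Nat.pow_le_pow_left hle m)
  -- Any bijection would do: it only makes rows and columns share an index type, so that a
  -- determinant exists.
  let σ : (Fin m → Fin q) ≃ Fin (q ^ m) := finFunctionFinEquiv
  let e : Module.Basis (Fin m → Fin q) L (Fin (q ^ m) → L) :=
    (Pi.basisFun L (Fin (q ^ m))).reindex σ.symm
  have hdet : IsUnit (e.det (GRM.rowMonomial q h hh.monic hh.natDegree_eq)) := by
    rw [← IsLocalRing.notMem_maximalIdeal, hL.maximalIdeal_eq, ← Ideal.Quotient.eq_zero_iff_mem,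
      Module.Basis.det_apply, RingHom.map_det]
    refine ne_of_eq_of_ne (congrArg Matrix.det (Matrix.ext fun k i ↦ ?_))
      (GRM.det_monomial_ne_zero hge _ (hbij.surjective.comp σ.surjective))
    simp [e, GRM.rowMonomial, GRM.genMatrix, Module.Basis.toMatrix_apply, Matrix.row]
  obtain ⟨hli, hspan⟩ := (Module.Basis.is_basis_iff_det e).2 hdet
  exact ⟨Module.Basis.mk hli hspan.ge, fun i ↦ Module.Basis.mk_apply hli hspan.ge i⟩
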